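/- Let $J:\mathbb{R}^p\to\mathbb{R}$ be convex and let $\partial J$ denote its subdifferential. For $\beta\in\mathbb{R}^p$ let $T_\beta$ be the orthogonal complement of the linear span of $\partial J(\beta)-\partial J(\beta)$. The function $J$ is partly smooth at $\beta$ relative to a set $\mathcal{M}\ni\beta$ if (i) $\mathcal{M}$ is a $C^2$-submanifold of $\mathbb{R}^p$ around $\beta$ and $J|_{\mathcal{M}}$ is $C^2$ around $\beta$, (ii) the tangent space of $\mathcal{M}$ at $\beta$ is $T_\beta$, and (iii) the set-valued map $\partial J$ is continuous (outer and inner semicontinuous) at $\beta$ relative to $\mathcal{M}$. It is locally partly smooth at $\beta\in\mathcal{M}$ relative to $\mathcal{M}$ if it is partly smooth relative to $\mathcal{M}$ at every point of $\mathcal{M}$ in some neighbourhood of $\beta$. **Theorem 1.** Let $J$ be locally partly smooth at $\beta_0$ relative to $\mathcal{M}$. Put $T=T_{\beta_0}$, let $P_T$ be the orthogonal projection onto $T$, and let $e$ be the single element of $P_T(\partial J(\beta_0))$. Suppose that $\tilde\Gamma\in\mathbb{R}^{p\times p}$ satisfies $$\ker(\tilde\Gamma)\cap T=\{0\}\qquad\text{and}\qquad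 \eta_{\tilde\Gamma}:=\tilde\Gamma\,(P_T\tilde\Gamma P_T)^+e\in\operatorname{ri}(\partial J(\beta_0)),$$ where $A^+$ is the Moore--Penrose pseudo-inverse and $\operatorname{ri}$ the relative interior. Then there are constants $C>0$ and $K>0$ such that for all $\mu>0$, all symmetric positive semidefinite $\Gamma\in\mathbb{R}^{p\times p}$ and all $u\in\operatorname{Im}(\Gamma)$, with $\varepsilon:=u-\Gamma\beta_0$: if $$\max\big(\|\Gamma-\tilde\Gamma\|,\ \|\varepsilon\|\mu^{-1},\ \mu\big)\le C,$$ then the problem $$\min_{\beta\in\mathbb{R}^p}\ J(\beta)+\frac1{2\mu}\langle\Gamma\beta,\beta\rangle-\frac1\mu\langle\beta,u\rangle+\frac1{2\mu}\langle\Gamma^+u,u\rangle$$ has exactly one solution $\beta_\theta$, and $$\beta_\theta\in\mathcal{M},\qquad \|\beta_\theta-\beta_0\|\le K\max(\|\varepsilon\|,\mu).$$ In particular $\|\beta_\theta-\beta_0\|=O(\|\varepsilon\|)$ when $\mu$ is proportional to the noise level: if $\mu\le c\|\varepsilon\|$, then $\|\beta_\theta-\beta_0\|\le K\max(1,c)\,\|\varepsilon\|$.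 -/

import Mathlib

open Set Filter Topology

noncomputable section

namespace PartlySmooth

/-- `ℝ^p` with its Euclidean inner product. Square matrices of size `p` are identified with the
(continuous) linear maps `Vec p →L[ℝ] Vec p`, normed by the operator norm. -/
abbrev Vec (p : ℕ) : Type := EuclideanSpace ℝ (Fin p)

/-! ### Convex analysis -/

/-- The convex subdifferential `∂J(β)`. -/
def subdiff {p : ℕ} (J : Vec p → ℝ) (β : Vec p) : Set (Vec p) :=
  {η | ∀ x : Vec p, J β + inner ℝ η (x - β) ≤ J x}

/-- The tangent model subspace `T_β`: the orthogonal complement of the linear space parallel to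
the affine hull of `∂J(β)`. -/
def modelSubspace {p : ℕ} (J : Vec p → ℝ) (β : Vec p) : Submodule ℝ (Vec p) :=
  (vectorSpan ℝ (subdiff J β))ᗮ

/-- The vector `e_β = P_{T_β}(∂J(β))`: the orthogonal projection onto `T_β` of any subgradient at
`β`. By `starProjection_eq_modelVector` it does not depend on the subgradient. -/
def modelVector {p : ℕ} (J : Vec p → ℝ) (β : Vec p) : Vec p :=
  (modelSubspace J β).starProjection (Classical.epsilon fun η => η ∈ subdiff J β)

theorem starProjection_eq_modelVector {p : ℕ} {J : Vec p → ℝ} {β η : Vec p}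
    (hη : η ∈ subdiff J β) :
    (modelSubspace J β).starProjection η = modelVector J β := by
  have h' : Classical.epsilon (fun ξ => ξ ∈ subdiff J β) ∈ subdiff J β :=
    Classical.epsilon_spec (p := fun ξ => ξ ∈ subdiff J β) ⟨η, hη⟩
  rw [modelVector, ← sub_eq_zero, ← map_sub, Submodule.starProjection_apply_eq_zero_iff,
    modelSubspace]
  exact Submodule.le_orthogonal_orthogonal _ (vsub_mem_vectorSpan ℝ hη h')

/-! ### Manifolds and partial smoothness -/

/-- `Φ` is a `C²` local equation of `M` around `β`: near `β` the set `M` is the zero set of the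
`C²` map `Φ`, whose derivative at `β ∈ M` is onto. -/
def IsLocalEquation {p k : ℕ} (M : Set (Vec p)) (β : Vec p) (Φ : Vec p → Vec k) : Prop :=
  β ∈ M ∧ Function.Surjective (fderiv ℝ Φ β) ∧
    ∃ V : Set (Vec p), IsOpen V ∧ β ∈ V ∧ ContDiffOn ℝ 2 Φ V ∧ M ∩ V = {x ∈ V | Φ x = 0}

/-- `M` is a `C²`-manifold around `β`. -/
def IsManifoldAround {p : ℕ} (M : Set (Vec p)) (β : Vec p) : Prop :=
  ∃ (k : ℕ) (Φ : Vec p → Vec k), IsLocalEquation M β Φ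

/-- `S` is the tangent space of `M` at `β`: the kernel of the derivative at `β` of a local equation
of `M` around `β` (this kernel is the same for all local equations). -/
def IsTangentSpace {p : ℕ} (M : Set (Vec p)) (β : Vec p) (S : Submodule ℝ (Vec p)) : Prop :=
  ∃ (k : ℕ) (Φ : Vec p → Vec k), IsLocalEquation M β Φ ∧
    S = LinearMap.ker (fderiv ℝ Φ β : Vec p →ₗ[ℝ] Vec k)

/-- The restriction of `J` to `M` is `C²` around `β`: near `β` it agrees on `M` with a `C²`
function. -/
def IsSmoothAlong {p : ℕ} (J : Vec p → ℝ) (M : Set (Vec p)) (β : Vec p) : Prop :=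
  ∃ (V : Set (Vec p)) (f : Vec p → ℝ), IsOpen V ∧ β ∈ V ∧ ContDiffOn ℝ 2 f V ∧
    EqOn J f (M ∩ V)

/-- Outer semicontinuity at `β`, relative to `M`, of a set-valued map. -/
def OuterSemicontinuousAt {p : ℕ} (F : Vec p → Set (Vec p)) (M : Set (Vec p)) (β : Vec p) : Prop :=
  ∀ (x η : ℕ → Vec p) (ζ : Vec p), (∀ n, x n ∈ M) → Tendsto x atTop (𝓝 β) →
    (∀ n, η n ∈ F (x n)) → Tendsto η atTop (𝓝 ζ) → ζ ∈ F β

/-- Inner semicontinuity at `β`, relative to `M`, of a set-valued map. -/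
def InnerSemicontinuousAt {p : ℕ} (F : Vec p → Set (Vec p)) (M : Set (Vec p)) (β : Vec p) : Prop :=
  ∀ (x : ℕ → Vec p) (ζ : Vec p), (∀ n, x n ∈ M) → Tendsto x atTop (𝓝 β) → ζ ∈ F β →
    ∃ η : ℕ → Vec p, (∀ n, η n ∈ F (x n)) ∧ Tendsto η atTop (𝓝 ζ)

/-- `J` is partly smooth at `β` relative to `M` (for a finite-valued convex function `J`). -/
structure PartlySmoothAt {p : ℕ} (J : Vec p → ℝ) (M : Set (Vec p)) (β : Vec p) : Prop where
  mem : β ∈ M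
  manifold : IsManifoldAround M β
  smooth : IsSmoothAlong J M β
  sharp : IsTangentSpace M β (modelSubspace J β)
  outer : OuterSemicontinuousAt (subdiff J) M β
  inner : InnerSemicontinuousAt (subdiff J) M β

/-- `J` is locally partly smooth at `β ∈ M` relative to `M`: it is partly smooth, relative to `M`,
at all points of `M` near `β`. -/
def LocallyPartlySmoothAt {p : ℕ} (J : Vec p → ℝ) (M : Set (Vec p)) (β : Vec p) : Prop :=
  β ∈ M ∧ ∃ U ∈ 𝓝 β, ∀ β' ∈ M ∩ U, PartlySmoothAt J M β'

/-! ### The Moore-Penrose pseudo-inverse -/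

/-- The bijection from `(ker A)ᗮ` onto the range of `A` that `A` induces. -/
def kerOrthogonalEquivRange {p : ℕ} (A : Vec p →L[ℝ] Vec p) :
    (LinearMap.ker (A : Vec p →ₗ[ℝ] Vec p))ᗮ ≃ₗ[ℝ] LinearMap.range (A : Vec p →ₗ[ℝ] Vec p) :=
  LinearEquiv.ofBijective
    ((A : Vec p →ₗ[ℝ] Vec p).rangeRestrict.domRestrict (LinearMap.ker (A : Vec p →ₗ[ℝ] Vec p))ᗮ) <| by
    constructor
    · rw [← LinearMap.ker_eq_bot, LinearMap.ker_eq_bot']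
      intro x hx
      have h1 : (x : Vec p) ∈ LinearMap.ker (A : Vec p →ₗ[ℝ] Vec p) := by
        simpa [Subtype.ext_iff] using hx
      have h2 := x.2 (x : Vec p) h1
      exact Subtype.ext (inner_self_eq_zero.mp h2)
    · rintro ⟨_, x, rfl⟩
      obtain ⟨y, hy, z, hz, rfl⟩ :=
        (LinearMap.ker (A : Vec p →ₗ[ℝ] Vec p)).exists_add_mem_mem_orthogonal x
      refine ⟨⟨z, hz⟩, Subtype.ext ?_⟩
      have hy' : A y = 0 := hy
      simp [hy']

/-- The Moore-Penrose pseudo-inverse `A⁺`: project orthogonally onto the range of `A`, then take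
the preimage under `A` that is orthogonal to `ker A`. -/
def pinv {p : ℕ} (A : Vec p →L[ℝ] Vec p) : Vec p →L[ℝ] Vec p :=
  LinearMap.toContinuousLinearMap
    ((LinearMap.ker (A : Vec p →ₗ[ℝ] Vec p))ᗮ.subtype ∘ₗ
      ((kerOrthogonalEquivRange A).symm : LinearMap.range (A : Vec p →ₗ[ℝ] Vec p) →ₗ[ℝ]
        (LinearMap.ker (A : Vec p →ₗ[ℝ] Vec p))ᗮ) ∘ₗ
      ((LinearMap.range (A : Vec p →ₗ[ℝ] Vec p)).orthogonalProjectionOnto :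
        Vec p →ₗ[ℝ] LinearMap.range (A : Vec p →ₗ[ℝ] Vec p)))

/-! ### The certificate and the penalized problem -/

/-- The compression `Γ_T = P_T Γ P_T`. -/
def compress {p : ℕ} (Γ : Vec p →L[ℝ] Vec p) (T : Submodule ℝ (Vec p)) : Vec p →L[ℝ] Vec p :=
  T.starProjection ∘L Γ ∘L T.starProjection

/-- The linearized pre-certificate `η_Γ = Γ Γ_T⁺ e`, where `T = T_β` and `e = e_β`. -/
def preCertificate {p : ℕ} (J : Vec p → ℝ) (β : Vec p) (Γ : Vec p →L[ℝ] Vec p) : Vec p :=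
  Γ (pinv (compress Γ (modelSubspace J β)) (modelVector J β))

/-- The objective `E(β, θ)` of the penalized least-squares problem with parameter
`θ = (μ, u, Γ)`. -/
def energy {p : ℕ} (J : Vec p → ℝ) (μ : ℝ) (u : Vec p) (Γ : Vec p →L[ℝ] Vec p) (β : Vec p) : ℝ :=
  J β + 1 / (2 * μ) * inner ℝ (Γ β) β - 1 / μ * inner ℝ β u
    + 1 / (2 * μ) * inner ℝ (pinv Γ u) u

/-- The set of solutions of the penalized problem with parameter `θ = (μ, u, Γ)`. -/
def solutions {p : ℕ} (J : Vec p → ℝ) (μ : ℝ) (u : Vec p) (Γ : Vec p →L[ℝ] Vec p) :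
    Set (Vec p) :=
  {β | ∀ β' : Vec p, energy J μ u Γ β ≤ energy J μ u Γ β'}

end PartlySmooth

end

noncomputable section

namespace PartlySmooth

variable {p k : ℕ}

/-! ### Geometry of manifolds given by local equations -/

/-! The candidate is a minimizer `β` of the energy over `M` intersected with a small closed ball
around `β₀`. Displacements in `M` are almost tangent, and an operator near `Γt` is coercive in
directions near `T`, so comparing energies gives `‖β - β₀‖ ≤ K max(‖ε‖, μ)`
(`norm_sub_le_of_energy_le`). Hence `β` is interior to the ball, and the residual `g = (u - Γ β)/μ`
agrees with all subgradients at `β` on the model subspace at `β` (`inner_eq_of_isLocalMinOn`).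

Since `(β - β₀)/μ` is bounded, this restricted optimality and coercivity force `g` to be close to
the certificate `η` (`exists_pos_forall_norm_certificate_sub_le`). As `η` is relatively interior,
inner semicontinuity makes every direction that is maximal at `g` on `∂J(β)` almost lie in `T`. A
hyperplane separating `g` from `∂J(β)` would have such a normal, and this normal would lie in the
model subspace at `β`, where `g` and the subgradients agree. So `g ∈ ∂J(β)` and `β` is a global
solution. The difference with a second solution is also a maximal direction, and `Γ` degenerates
along it; coercivity makes it zero. -/

theorem IsLocalEquation.nhdsWithin_eq {M : Set (Vec p)} {β : Vec p} {Φ : Vec p → Vec k}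
    (h : IsLocalEquation M β Φ) : 𝓝[M] β = 𝓝[{x | Φ x = Φ β}] β := by
  obtain ⟨hβ, -, V, hV, hβV, -, hMV⟩ := h
  have h0 : Φ β = 0 := (hMV.subset ⟨hβ, hβV⟩).2
  refine nhdsWithin_eq_nhdsWithin hβV hV ?_
  rw [hMV, h0]
  ext x
  exact and_comm

theorem IsLocalEquation.contDiffAt {M : Set (Vec p)} {β : Vec p} {Φ : Vec p → Vec k}
    (h : IsLocalEquation M β Φ) : ContDiffAt ℝ 2 Φ β := by
  obtain ⟨-, -, V, hV, hβV, hΦ, -⟩ := h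
  exact hΦ.contDiffAt (hV.mem_nhds hβV)

/-- The derivative of a function at a local extremum on `M` vanishes on the tangent space. -/
theorem IsLocalEquation.fderiv_apply_eq_zero {M : Set (Vec p)} {β : Vec p} {Φ : Vec p → Vec k}
    (h : IsLocalEquation M β Φ) {φ : Vec p → ℝ} (hφ : ContDiffAt ℝ 2 φ β)
    (hext : IsLocalExtrOn φ M β) {v : Vec p} (hv : fderiv ℝ Φ β v = 0) :
    fderiv ℝ φ β v = 0 := by
  have hext' : IsLocalExtrOn φ {x | Φ x = Φ β} β := by
    rwa [IsLocalExtrOn, ← h.nhdsWithin_eq]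
  obtain ⟨Λ, Λ₀, hne, hΛ⟩ := hext'.exists_linear_map_of_hasStrictFDerivAt
    (h.contDiffAt.hasStrictFDerivAt two_ne_zero) (hφ.hasStrictFDerivAt two_ne_zero)
  -- Surjectivity of the constraint derivative excludes abnormal Lagrange multipliers.
  have hΛ₀ : Λ₀ ≠ 0 := by
    rintro rfl
    refine hne (Prod.ext (LinearMap.ext fun y => ?_) rfl)
    obtain ⟨x, rfl⟩ := h.2.1 y
    simpa using hΛ x
  simpa [hv, hΛ₀] using hΛ v

/-- The tangent space does not depend on the local equation. -/
theorem IsLocalEquation.ker_fderiv_le {M : Set (Vec p)} {β : Vec p} {Φ : Vec p → Vec k}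
    {l : ℕ} {Ψ : Vec p → Vec l} (hΦ : IsLocalEquation M β Φ) (hΨ : IsLocalEquation M β Ψ)
    {v : Vec p} (hv : fderiv ℝ Φ β v = 0) : fderiv ℝ Ψ β v = 0 := by
  set w := fderiv ℝ Ψ β v with hw
  -- The test function `⟪w, Ψ ·⟫` is constant on `M` near `β`, hence extremal there; its derivative
  -- along `v` is `‖w‖²`.
  have hcd : ContDiffAt ℝ 2 (fun x => innerSL ℝ w (Ψ x)) β :=
    (innerSL ℝ w).contDiff.contDiffAt.comp β hΨ.contDiffAt
  have hext : IsLocalExtrOn (fun x => innerSL ℝ w (Ψ x)) M β := by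
    refine Or.inl ?_
    rw [IsMinFilter, hΨ.nhdsWithin_eq]
    filter_upwards [self_mem_nhdsWithin] with x hx
    exact (congrArg (innerSL ℝ w) hx).ge
  have h0 := hΦ.fderiv_apply_eq_zero hcd hext hv
  have hd : HasFDerivAt (fun x => innerSL ℝ w (Ψ x)) ((innerSL ℝ w).comp (fderiv ℝ Ψ β)) β :=
    (innerSL ℝ w).hasFDerivAt.comp β (hΨ.contDiffAt.differentiableAt two_ne_zero).hasFDerivAt
  rw [hd.fderiv] at h0
  simpa [← hw] using h0

/-- If `R` is a right inverse of `A`, then `B ∘ R` is invertible for `B` near `A`, and `R (B R)⁻¹`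
is a right inverse of `B`. Subtracting `R (B R)⁻¹ B t` corrects `t`; this is small because `B t = (B
- A) t`. -/
theorem eventually_surjective_and_exists_near_mem_ker {A : Vec p →L[ℝ] Vec k}
    (hA : Function.Surjective A) {s : ℝ} (hs : 0 < s) :
    ∀ᶠ B : Vec p →L[ℝ] Vec k in 𝓝 A, Function.Surjective B ∧
      ∀ t, A t = 0 → ∃ t', B t' = 0 ∧ ‖t - t'‖ ≤ s * ‖t‖ := by
  obtain ⟨R, hR⟩ := A.exists_rightInverse_of_surjective (LinearMap.range_eq_top.2 hA)
  have hcont : Continuous fun B : Vec p →L[ℝ] Vec k => B ∘L R := by fun_prop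
  have hunit : ∀ᶠ B in 𝓝 A, IsUnit (B ∘L R) := by
    refine hcont.continuousAt.eventually (Units.isOpen.mem_nhds ?_)
    change IsUnit (A ∘L R)
    rw [hR]
    exact isUnit_one
  have hinv : ContinuousAt (fun B : Vec p →L[ℝ] Vec k =>
      ‖R ∘L Ring.inverse (B ∘L R)‖ * ‖B - A‖) A := by
    have h1 : ContinuousAt (fun B : Vec p →L[ℝ] Vec k => Ring.inverse (B ∘L R)) A := by
      refine ContinuousAt.comp (g := Ring.inverse) ?_ hcont.continuousAt
      rw [hR]
      exact NormedRing.inverse_continuousAt 1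
    have h2 : ContinuousAt (fun B : Vec p →L[ℝ] Vec k => R ∘L Ring.inverse (B ∘L R)) A :=
      ((ContinuousLinearMap.compL ℝ (Vec k) (Vec k) (Vec p) R).continuous.continuousAt).comp h1
    exact h2.norm.mul (by fun_prop)
  have hsmall : ∀ᶠ B in 𝓝 A, ‖R ∘L Ring.inverse (B ∘L R)‖ * ‖B - A‖ < s := by
    refine hinv.eventually (gt_mem_nhds ?_)
    simpa using hs
  filter_upwards [hunit, hsmall] with B hB hBs
  have key : ∀ y, B (R (Ring.inverse (B ∘L R) y)) = y := fun y => by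
    have := Ring.mul_inverse_cancel _ hB
    exact congrArg (fun f : Vec k →L[ℝ] Vec k => f y) this
  refine ⟨fun y => ⟨_, key y⟩, fun t ht => ?_⟩
  refine ⟨t - R (Ring.inverse (B ∘L R) (B t)), by rw [map_sub, key, sub_self], ?_⟩
  rw [sub_sub_cancel]
  have hBt : B t = (B - A) t := by simp [ht]
  calc ‖R (Ring.inverse (B ∘L R) (B t))‖ = ‖(R ∘L Ring.inverse (B ∘L R)) ((B - A) t)‖ := by
        rw [hBt]; rfl
    _ ≤ ‖R ∘L Ring.inverse (B ∘L R)‖ * (‖B - A‖ * ‖t‖) :=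
        (ContinuousLinearMap.le_opNorm _ _).trans (by gcongr; exact ContinuousLinearMap.le_opNorm _ _)
    _ ≤ s * ‖t‖ := by rw [← mul_assoc]; gcongr

/-- The model subspaces at points of `M` near `β₀` almost contain the one at `β₀`. -/
theorem LocallyPartlySmoothAt.eventually_exists_near_mem_modelSubspace
    {J : Vec p → ℝ} {M : Set (Vec p)} {β₀ : Vec p} (h : LocallyPartlySmoothAt J M β₀)
    {s : ℝ} (hs : 0 < s) :
    ∀ᶠ β in 𝓝[M] β₀, ∀ t ∈ modelSubspace J β₀, ∃ t' ∈ modelSubspace J β,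
      ‖t - t'‖ ≤ s * ‖t‖ := by
  obtain ⟨hβ₀, U, hU, hps⟩ := h
  obtain ⟨k, Φ, hΦ, hT⟩ := (hps β₀ ⟨hβ₀, mem_of_mem_nhds hU⟩).sharp
  have hΦ' := hΦ
  obtain ⟨-, hsurj, V, hV, hβV, hcd, hMV⟩ := hΦ'
  have hcont : ContinuousAt (fderiv ℝ Φ) β₀ :=
    (hΦ.contDiffAt.fderiv_right (m := 1) (by norm_num)).continuousAt
  filter_upwards [nhdsWithin_le_nhds
      (hcont.eventually (eventually_surjective_and_exists_near_mem_ker hsurj hs)),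
    self_mem_nhdsWithin, nhdsWithin_le_nhds hU, nhdsWithin_le_nhds (hV.mem_nhds hβV)]
    with β ⟨hβs, hβt⟩ hβM hβU hβV'
  obtain ⟨l, Ψ, hΨ, hTβ⟩ := (hps β ⟨hβM, hβU⟩).sharp
  -- The equation at `β₀` still serves at `β`; it may differ from `Ψ`, but both have the same
  -- tangent space.
  have hΦβ : IsLocalEquation M β Φ := ⟨hβM, hβs, V, hV, hβV', hcd, hMV⟩
  intro t ht
  rw [hT] at ht
  obtain ⟨t', ht', hle⟩ := hβt t ht
  refine ⟨t', ?_, hle⟩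
  rw [hTβ]
  exact hΦβ.ker_fderiv_le hΨ ht'

theorem norm_sub_starProjection_le (T : Submodule ℝ (Vec p)) (x : Vec p) {t : Vec p}
    (ht : t ∈ T) : ‖x - T.starProjection x‖ ≤ ‖x - t‖ := by
  rw [Submodule.starProjection_minimal]
  exact ciInf_le ⟨0, by rintro _ ⟨y, rfl⟩; exact norm_nonneg _⟩ (⟨t, ht⟩ : T)

/-- Near `β₀` the displacements in `M` are almost tangent to `M`. -/
theorem IsTangentSpace.eventually_norm_sub_starProjection_le {M : Set (Vec p)} {β₀ : Vec p}
    {T : Submodule ℝ (Vec p)} (h : IsTangentSpace M β₀ T) {s : ℝ} (hs : 0 < s) :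
    ∀ᶠ β in 𝓝[M] β₀, ‖(β - β₀) - T.starProjection (β - β₀)‖ ≤ s * ‖β - β₀‖ := by
  obtain ⟨k, Φ, hΦ, hT⟩ := h
  obtain ⟨R, hR⟩ := (fderiv ℝ Φ β₀).exists_rightInverse_of_surjective
    (LinearMap.range_eq_top.2 hΦ.2.1)
  have hd := (hΦ.contDiffAt.differentiableAt two_ne_zero).hasFDerivAt.isLittleO
  have hpos : 0 < s / (‖R‖ + 1) := by positivity
  have hd' := nhdsWithin_le_nhds (s := M) (hd.def hpos)
  rw [hΦ.nhdsWithin_eq] at hd' ⊢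
  filter_upwards [hd', self_mem_nhdsWithin] with β hβ hΦβ
  have hΦβ' : Φ β = Φ β₀ := hΦβ
  simp only [hΦβ', sub_self, zero_sub, norm_neg] at hβ
  set δ := β - β₀
  -- Because `Φ β = Φ β₀`, the vector `Φ'(β₀) δ` is `o(δ)`, so this tangent vector is close to `δ`.
  have hmem : δ - R (fderiv ℝ Φ β₀ δ) ∈ T := by
    rw [hT]
    have := congrArg (fun f : Vec k →L[ℝ] Vec k => f (fderiv ℝ Φ β₀ δ)) hR
    simp at this
    simp [this]
  refine (norm_sub_starProjection_le T δ hmem).trans ?_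
  rw [sub_sub_cancel]
  calc ‖R (fderiv ℝ Φ β₀ δ)‖ ≤ ‖R‖ * (s / (‖R‖ + 1) * ‖δ‖) :=
        (R.le_opNorm _).trans (by gcongr)
    _ = ‖R‖ / (‖R‖ + 1) * (s * ‖δ‖) := by ring
    _ ≤ 1 * (s * ‖δ‖) := by
        gcongr
        rw [div_le_one (by positivity)]
        linarith
    _ = s * ‖δ‖ := one_mul _

/-! ### Subdifferentials near `β₀` -/

theorem InnerSemicontinuousAt.eventually_exists_near {F : Vec p → Set (Vec p)} {M : Set (Vec p)}
    {β₀ ζ : Vec p} (h : InnerSemicontinuousAt F M β₀) (hζ : ζ ∈ F β₀) {s : ℝ} (hs : 0 < s) :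
    ∀ᶠ β in 𝓝[M] β₀, ∃ ψ ∈ F β, ‖ψ - ζ‖ ≤ s := by
  by_contra hcon
  rw [not_eventually] at hcon
  obtain ⟨x, hx, hxs⟩ := exists_seq_forall_of_frequently
    (hcon.and_eventually (self_mem_nhdsWithin : ∀ᶠ β in 𝓝[M] β₀, β ∈ M))
  obtain ⟨η, hη, hlim⟩ := h x ζ (fun n => (hxs n).2) (hx.mono_right nhdsWithin_le_nhds) hζ
  obtain ⟨n, hn⟩ := (hlim.eventually (Metric.closedBall_mem_nhds ζ hs)).exists
  exact (hxs n).1 ⟨η n, hη n, by rw [← dist_eq_norm]; exact hn⟩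

theorem isClosed_subdiff (J : Vec p → ℝ) (β : Vec p) : IsClosed (subdiff J β) := by
  simp only [subdiff, ofPred_forall]
  exact isClosed_iInter fun x => isClosed_le (by fun_prop) continuous_const

theorem convex_subdiff (J : Vec p → ℝ) (β : Vec p) : Convex ℝ (subdiff J β) := by
  intro η hη ζ hζ a b ha hb hab x
  have h1 := mul_le_mul_of_nonneg_left (hη x) ha
  have h2 := mul_le_mul_of_nonneg_left (hζ x) hb
  rw [inner_add_left, real_inner_smul_left, real_inner_smul_left]
  have e1 : J β = a * J β + b * J β := by rw [← add_mul, hab, one_mul]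
  have e2 : J x = a * J x + b * J x := by rw [← add_mul, hab, one_mul]
  linarith

theorem exists_add_mem_of_mem_intrinsicInterior {S : Set (Vec p)} {η : Vec p}
    (hη : η ∈ intrinsicInterior ℝ S) :
    ∃ r > 0, ∀ w ∈ vectorSpan ℝ S, ‖w‖ ≤ r → η + w ∈ S := by
  obtain ⟨y, hy, rfl⟩ := mem_intrinsicInterior.1 hη
  obtain ⟨r, hr, hball⟩ := Metric.nhds_basis_closedBall.mem_iff.1 (mem_interior_iff_mem_nhds.1 hy)
  refine ⟨r, hr, fun w hw hwr => ?_⟩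
  have hmem : (y : Vec p) + w ∈ affineSpan ℝ S := by
    have := AffineSubspace.vadd_mem_of_mem_direction (s := affineSpan ℝ S) (v := w)
      (by rwa [direction_affineSpan]) y.2
    rwa [vadd_eq_add, add_comm] at this
  exact hball (show (⟨(y : Vec p) + w, hmem⟩ : affineSpan ℝ S) ∈ Metric.closedBall y r by
    rw [Metric.mem_closedBall, Subtype.dist_eq, dist_eq_norm]; simpa using hwr)

/-- If `⟪·, d⟫` is maximal on `∂J(β)` in the vector `g`, then `d` is almost in `T_{β₀}`, provided
that `g` is near a vector in the relative interior of `∂J(β₀)`. -/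
theorem InnerSemicontinuousAt.eventually_norm_sub_starProjection_le {J : Vec p → ℝ}
    {M : Set (Vec p)} {β₀ η : Vec p} (h : InnerSemicontinuousAt (subdiff J) M β₀)
    (hη : η ∈ intrinsicInterior ℝ (subdiff J β₀)) :
    ∃ c > 0, ∀ s > 0, ∀ᶠ β in 𝓝[M] β₀, ∀ g d : Vec p,
      (∀ ψ ∈ subdiff J β, inner ℝ ψ d ≤ inner ℝ g d) →
      ‖d - (modelSubspace J β₀).starProjection d‖ ≤ c * (s + ‖g - η‖) * ‖d‖ := by
  obtain ⟨r, hr, hball⟩ := exists_add_mem_of_mem_intrinsicInterior hη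
  set N := vectorSpan ℝ (subdiff J β₀) with hN
  let b := stdOrthonormalBasis ℝ N
  set n := Module.finrank ℝ N
  have hbn : ∀ i, ‖(b i : Vec p)‖ = 1 := fun i => b.orthonormal.1 i
  -- The sum of `n` coordinate bounds gives `n / r`; the extra `1` keeps the constant positive when
  -- `n = 0`.
  refine ⟨(n + 1) / r, by positivity, fun s hs => ?_⟩
  -- The points `η ± r bᵢ` lie in `∂J(β₀)`. There are finitely many, so they can be approximated in
  -- `∂J(β)` simultaneously; testing `d` on them bounds its coordinates in both signs.
  have hplus : ∀ᶠ β in 𝓝[M] β₀, ∀ i, ∃ ψ ∈ subdiff J β, ‖ψ - (η + r • (b i : Vec p))‖ ≤ s := by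
    rw [eventually_all]
    refine fun i => h.eventually_exists_near (hball _ (N.smul_mem _ (b i).2) ?_) hs
    rw [norm_smul, hbn, mul_one, Real.norm_of_nonneg hr.le]
  have hminus : ∀ᶠ β in 𝓝[M] β₀, ∀ i,
      ∃ ψ ∈ subdiff J β, ‖ψ - (η + (-r) • (b i : Vec p))‖ ≤ s := by
    rw [eventually_all]
    refine fun i => h.eventually_exists_near (hball _ (N.smul_mem _ (b i).2) ?_) hs
    rw [norm_smul, hbn, mul_one, norm_neg, Real.norm_of_nonneg hr.le]
  filter_upwards [hplus, hminus] with β hp hm g d hgd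
  have bound : ∀ (a : ℝ) (w ψ : Vec p), ψ ∈ subdiff J β → ‖ψ - (η + a • w)‖ ≤ s →
      a * inner ℝ w d ≤ (s + ‖g - η‖) * ‖d‖ := by
    intro a w ψ hψ hle
    have e : a * inner ℝ w d = inner ℝ ψ d - inner ℝ g d + inner ℝ (g - η) d
        + inner ℝ (-(ψ - (η + a • w))) d := by
      simp only [inner_sub_left, inner_neg_left, inner_add_left, real_inner_smul_left]
      ring
    have h1 : inner ℝ (g - η) d ≤ ‖g - η‖ * ‖d‖ := real_inner_le_norm _ _
    have h2 : inner ℝ (-(ψ - (η + a • w))) d ≤ s * ‖d‖ := by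
      refine (real_inner_le_norm _ _).trans ?_
      rw [norm_neg]
      gcongr
    have h3 := hgd ψ hψ
    linarith
  have hcoord : ∀ i, |inner ℝ (b i : Vec p) d| ≤ (s + ‖g - η‖) * ‖d‖ / r := by
    intro i
    obtain ⟨ψ, hψ, hle⟩ := hp i
    obtain ⟨ξ, hξ, hle'⟩ := hm i
    have h1 := bound _ _ _ hψ hle
    have h2 := bound _ _ _ hξ hle'
    refine abs_le.2 ⟨?_, ?_⟩
    · rw [neg_le, le_div_iff₀ hr]
      linarith
    · rw [le_div_iff₀ hr]
      linarith
  have hproj : d - (modelSubspace J β₀).starProjection d =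
      ∑ i, (inner ℝ (b i : Vec p) d : ℝ) • (b i : Vec p) := by
    have e : d - (modelSubspace J β₀).starProjection d = N.starProjection d := by
      rw [sub_eq_iff_eq_add']
      have := N.starProjection_add_starProjection_orthogonal d
      rw [add_comm]
      exact this.symm
    rw [e, Submodule.starProjection_apply, b.orthogonalProjectionOnto_apply_eq_sum d]
    simp
  rw [hproj]
  calc ‖∑ i, (inner ℝ (b i : Vec p) d : ℝ) • (b i : Vec p)‖
      ≤ ∑ i, (s + ‖g - η‖) * ‖d‖ / r := by
        refine norm_sum_le_of_le _ fun i _ => ?_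
        rw [norm_smul, hbn, mul_one]
        exact hcoord i
    _ = n / r * (s + ‖g - η‖) * ‖d‖ := by
        rw [Finset.sum_const, Finset.card_univ, Fintype.card_fin, nsmul_eq_mul]
        ring
    _ ≤ (n + 1) / r * (s + ‖g - η‖) * ‖d‖ := by
        gcongr
        linarith

end PartlySmooth

end

noncomputable section

namespace PartlySmooth

variable {p : ℕ}

/-! ### Positive operators -/

theorem isClosed_isPositive : IsClosed {Γ : Vec p →L[ℝ] Vec p | Γ.IsPositive} := by
  have h : {Γ : Vec p →L[ℝ] Vec p | Γ.IsPositive} =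
      (⋂ x, ⋂ y, {Γ : Vec p →L[ℝ] Vec p | inner ℝ (Γ x) y = inner ℝ x (Γ y)}) ∩
        ⋂ x, {Γ : Vec p →L[ℝ] Vec p | 0 ≤ inner ℝ (Γ x) x} := by
    ext Γ
    simp only [mem_inter_iff, mem_iInter]
    rfl
  rw [h]
  refine (isClosed_iInter fun x => isClosed_iInter fun y => ?_).inter (isClosed_iInter fun x => ?_)
  · exact isClosed_eq (by fun_prop) (by fun_prop)
  · exact isClosed_le (by fun_prop) (by fun_prop)

theorem inner_apply_comm {Γ : Vec p →L[ℝ] Vec p} (hΓ : Γ.IsPositive) (x y : Vec p) :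
    inner ℝ (Γ x) y = inner ℝ (Γ y) x :=
  (hΓ.1 x y).trans (real_inner_comm _ _)

theorem inner_apply_self_nonneg {Γ : Vec p →L[ℝ] Vec p} (hΓ : Γ.IsPositive) (x : Vec p) :
    0 ≤ inner ℝ (Γ x) x := hΓ.2 x

theorem apply_eq_zero_of_inner_self {Γ : Vec p →L[ℝ] Vec p} (hΓ : Γ.IsPositive) {x : Vec p}
    (hx : inner ℝ (Γ x) x = 0) : Γ x = 0 := by
  by_contra hne
  set y := Γ x with hy
  have hy0 : 0 < inner ℝ y y := real_inner_self_pos.2 hne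
  have key : ∀ a : ℝ, 0 ≤ 2 * a * inner ℝ y y + a ^ 2 * inner ℝ (Γ y) y := fun a => by
    have h := inner_apply_self_nonneg hΓ (x + a • y)
    have hc := inner_apply_comm hΓ y x
    simp only [map_add, map_smul, inner_add_left, inner_add_right, real_inner_smul_left,
      real_inner_smul_right, ← hy, hx, hc] at h
    linarith
  have hq : 0 ≤ inner ℝ (Γ y) y := inner_apply_self_nonneg hΓ y
  set q := inner ℝ (Γ y) y
  set n := inner ℝ y y
  -- A small negative multiple makes the linear term dominate; the `+ 1` covers `q = 0`.
  have h := key (-(n / (q + 1)))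
  have e : 2 * -(n / (q + 1)) * n + (-(n / (q + 1))) ^ 2 * q
      = -(n ^ 2 * (q + 2) / (q + 1) ^ 2) := by
    field_simp
    ring
  rw [e] at h
  have : 0 < n ^ 2 * (q + 2) / (q + 1) ^ 2 := by positivity
  linarith

/-- A positive operator that is injective on `T` is coercive transversally to `Tᗮ`. -/
theorem exists_coercive {Γ : Vec p →L[ℝ] Vec p} (hΓ : Γ.IsPositive) {T : Submodule ℝ (Vec p)}
    (hker : LinearMap.ker (Γ : Vec p →ₗ[ℝ] Vec p) ⊓ T = ⊥) :
    ∃ κ > 0, ∀ v, κ * ‖v‖ ^ 2 ≤ inner ℝ (Γ v) v + ‖v - T.starProjection v‖ ^ 2 := by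
  set q : Vec p → ℝ := fun v => inner ℝ (Γ v) v + ‖v - T.starProjection v‖ ^ 2 with hq
  have hpos : ∀ v, v ≠ 0 → 0 < q v := by
    intro v hv
    have h1 := inner_apply_self_nonneg hΓ v
    have h2 := sq_nonneg ‖v - T.starProjection v‖
    refine lt_of_le_of_ne (add_nonneg h1 h2) fun h0 => hv ?_
    have e1 : inner ℝ (Γ v) v = 0 := by simp only [hq] at h0; linarith
    have e2 : ‖v - T.starProjection v‖ ^ 2 = 0 := by simp only [hq] at h0; linarith
    rw [sq_eq_zero_iff, norm_eq_zero, sub_eq_zero] at e2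
    have hmem : v ∈ LinearMap.ker (Γ : Vec p →ₗ[ℝ] Vec p) ⊓ T := by
      refine ⟨apply_eq_zero_of_inner_self hΓ e1, ?_⟩
      rw [e2]
      exact Submodule.starProjection_apply_mem _ _
    rwa [hker, Submodule.mem_bot] at hmem
  have hhom : ∀ (a : ℝ) v, q (a • v) = a ^ 2 * q v := by
    intro a v
    simp only [hq, map_smul, ← smul_sub, norm_smul, mul_pow, real_inner_smul_left,
      real_inner_smul_right, Real.norm_eq_abs, sq_abs]
    ring
  obtain ⟨κ, hκ, hle⟩ : ∃ κ > 0, ∀ v ∈ Metric.sphere (0 : Vec p) 1, κ ≤ q v := by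
    -- The sphere is empty when `p = 0`.
    rcases (Metric.sphere (0 : Vec p) 1).eq_empty_or_nonempty with he | hne
    · exact ⟨1, one_pos, by simp [he]⟩
    · obtain ⟨v, hv, hmin⟩ := (isCompact_sphere (0 : Vec p) 1).exists_isMinOn hne
        (show Continuous q by fun_prop).continuousOn
      exact ⟨q v, hpos v (ne_zero_of_mem_unit_sphere ⟨v, hv⟩), fun w hw => hmin hw⟩
  refine ⟨κ, hκ, fun v => ?_⟩
  change κ * ‖v‖ ^ 2 ≤ q v
  rcases eq_or_ne v 0 with rfl | hv
  · simp [hq]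
  · have hn : ‖v‖ ≠ 0 := norm_ne_zero_iff.2 hv
    have h1 := hle (‖v‖⁻¹ • v) (by simp [norm_smul, hn])
    have h2 := hhom ‖v‖ (‖v‖⁻¹ • v)
    rw [smul_inv_smul₀ hn] at h2
    rw [h2, mul_comm]
    gcongr

/-- The transversal part and the perturbation of `Γt` each cost at most `κ / 4`. -/
theorem half_coercive {Γ Γt : Vec p →L[ℝ] Vec p} {T : Submodule ℝ (Vec p)} {κ τ : ℝ}
    (hκ : ∀ v, κ * ‖v‖ ^ 2 ≤ inner ℝ (Γt v) v + ‖v - T.starProjection v‖ ^ 2)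
    (hτ : τ ^ 2 ≤ κ / 4) (hΓ : ‖Γ - Γt‖ ≤ κ / 4) {v : Vec p}
    (hv : ‖v - T.starProjection v‖ ≤ τ * ‖v‖) : κ / 2 * ‖v‖ ^ 2 ≤ inner ℝ (Γ v) v := by
  have h1 : -inner ℝ ((Γ - Γt) v) v ≤ κ / 4 * ‖v‖ * ‖v‖ := by
    rw [← inner_neg_left]
    refine (real_inner_le_norm _ _).trans ?_
    rw [norm_neg]
    gcongr
    exact (Γ - Γt).le_of_opNorm_le hΓ v
  have h2 : ‖v - T.starProjection v‖ ^ 2 ≤ κ / 4 * ‖v‖ ^ 2 := by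
    calc ‖v - T.starProjection v‖ ^ 2 ≤ (τ * ‖v‖) ^ 2 := by gcongr
      _ = τ ^ 2 * ‖v‖ ^ 2 := mul_pow _ _ _
      _ ≤ κ / 4 * ‖v‖ ^ 2 := by gcongr
  have h3 : inner ℝ ((Γ - Γt) v) v = inner ℝ (Γ v) v - inner ℝ (Γt v) v := by
    rw [sub_apply, inner_sub_left]
  have := hκ v
  nlinarith

/-- Values of the pseudo-inverse are orthogonal to the kernel, and the compression kills `Tᗮ`. -/
theorem pinv_compress_mem (Γ : Vec p →L[ℝ] Vec p) (T : Submodule ℝ (Vec p)) (e : Vec p) :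
    pinv (compress Γ T) e ∈ T := by
  have h1 : pinv (compress Γ T) e ∈
      (LinearMap.ker (compress Γ T : Vec p →ₗ[ℝ] Vec p))ᗮ := by
    simp only [pinv, LinearMap.coe_toContinuousLinearMap', LinearMap.comp_apply]
    exact Subtype.property _
  have h2 : Tᗮ ≤ LinearMap.ker (compress Γ T : Vec p →ₗ[ℝ] Vec p) := fun x hx => by
    have hx' : T.starProjection x = 0 := (Submodule.starProjection_apply_eq_zero_iff T).2 hx
    simp [compress, hx']
  exact T.orthogonal_orthogonal.le (Submodule.orthogonal_le h2 h1)

/-- Stability of the certificate: the vector `a - Γ v` is near `-Γt v₀` if `Γ` is near `Γt`, `a` is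
small, `v` is almost in `T`, and `a - Γ v` agrees on a subspace near `T` with a vector near
`-Γt v₀`. -/
theorem exists_pos_forall_norm_certificate_sub_le {Γt : Vec p →L[ℝ] Vec p}
    {T : Submodule ℝ (Vec p)} {κ : ℝ} (hκ0 : 0 < κ)
    (hκ : ∀ v, κ * ‖v‖ ^ 2 ≤ inner ℝ (Γt v) v + ‖v - T.starProjection v‖ ^ 2)
    {v₀ : Vec p} (hv₀ : v₀ ∈ T) {K ρ : ℝ} (hK : 0 < K) (hρ : 0 < ρ) :
    ∃ s > 0, ∀ (S : Submodule ℝ (Vec p)) (Γ : Vec p →L[ℝ] Vec p) (a v ψ : Vec p),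
      ‖Γ - Γt‖ ≤ s → ‖a‖ ≤ s → ‖v‖ ≤ K → ‖v - T.starProjection v‖ ≤ s * ‖v‖ →
      ‖ψ - -Γt v₀‖ ≤ s → (∀ t ∈ T, ∃ t' ∈ S, ‖t - t'‖ ≤ s * ‖t‖) →
      (∀ w ∈ S, inner ℝ ψ w = inner ℝ (a - Γ v) w) → ‖(a - Γ v) - -Γt v₀‖ ≤ ρ := by
  -- `H` bounds `v - v₀`, `G` bounds `ψ - g`, and `s * B` collects all errors in the coercivity
  -- estimate for `v - v₀`.
  set H := K + ‖v₀‖ with hH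
  set G := (‖Γt v₀‖ + 1) + (1 + (‖Γt‖ + 1) * K) with hG
  set B := K ^ 2 + (2 + K) * H + G * (K + H) with hB
  have hcont : Tendsto (fun s : ℝ => s + s * K + ‖Γt‖ * √(s * B / κ)) (𝓝[>] 0) (𝓝 0) := by
    have : Continuous fun s : ℝ => s + s * K + ‖Γt‖ * √(s * B / κ) := by fun_prop
    have h := this.tendsto 0
    simp only [zero_mul, zero_div, Real.sqrt_zero, mul_zero, add_zero] at h
    exact h.mono_left nhdsWithin_le_nhds
  obtain ⟨s, ⟨hsρ, hs1⟩, hs0⟩ := ((hcont.eventually (gt_mem_nhds hρ)).and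
    (nhdsWithin_le_nhds (gt_mem_nhds one_pos)) |>.and self_mem_nhdsWithin).exists
  have hs0 : 0 < s := hs0
  have hs1 : s < 1 := hs1
  refine ⟨s, hs0, fun S Γ a v ψ hΓ ha hv hvT hψ hTS hS => ?_⟩
  set g := a - Γ v with hg
  set h := v - v₀ with hh
  have hhH : ‖h‖ ≤ H := (norm_sub_le _ _).trans (by linarith)
  have hH0 : 0 ≤ H := (norm_nonneg _).trans hhH
  have hhT : h - T.starProjection h = v - T.starProjection v := by
    rw [hh, map_sub, T.starProjection_eq_self_iff.2 hv₀]
    abel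
  have hvT' : ‖h - T.starProjection h‖ ≤ s * K := by
    rw [hhT]
    exact hvT.trans (by gcongr)
  obtain ⟨t', ht', htle⟩ := hTS _ (T.starProjection_apply_mem h)
  have htle' : ‖T.starProjection h - t'‖ ≤ s * H := by
    refine htle.trans ?_
    gcongr
    exact (T.norm_starProjection_apply_le h).trans hhH
  have hΓv : ‖(Γ - Γt) v‖ ≤ s * K := ((Γ - Γt).le_of_opNorm_le hΓ v).trans (by gcongr)
  have hΓn : ‖Γ‖ ≤ ‖Γt‖ + 1 := by
    have := norm_le_norm_add_norm_sub' Γ Γt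
    linarith
  have hgn : ‖g‖ ≤ 1 + (‖Γt‖ + 1) * K := by
    refine (norm_sub_le _ _).trans (add_le_add (ha.trans hs1.le) ?_)
    exact (Γ.le_opNorm v).trans (by gcongr)
  have hψn : ‖ψ‖ ≤ ‖Γt v₀‖ + 1 := by
    have := norm_le_norm_add_norm_sub' ψ (-Γt v₀)
    rw [norm_neg] at this
    linarith
  have hψg : ‖ψ - g‖ ≤ G := (norm_sub_le _ _).trans (by linarith)
  have hG0 : 0 ≤ G := (norm_nonneg _).trans hψg
  have hht : ‖h - t'‖ ≤ s * K + s * H := by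
    have e : h - t' = (h - T.starProjection h) + (T.starProjection h - t') := by abel
    rw [e]
    exact (norm_add_le _ _).trans (add_le_add hvT' htle')
  -- Only `ψ - g` is not small a priori, but it annihilates `S`, so `h` may be replaced by `h - t'`
  -- in its pairing.
  have hsplit : inner ℝ (Γt h) h = inner ℝ (-(ψ - -Γt v₀)) h + inner ℝ (ψ - g) (h - t')
      + inner ℝ a h + inner ℝ (-((Γ - Γt) v)) h := by
    have h0 : inner ℝ (ψ - g) t' = 0 := by rw [inner_sub_left, hS t' ht', sub_self]
    rw [inner_sub_right (ψ - g), h0, sub_zero, ← inner_add_left, ← inner_add_left, ← inner_add_left]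
    congr 1
    simp only [hg, hh, map_sub, sub_apply]
    abel
  have i1 : inner ℝ (-(ψ - -Γt v₀)) h ≤ s * H := by
    refine (real_inner_le_norm _ _).trans ?_
    rw [norm_neg]
    gcongr
  have i2 : inner ℝ (ψ - g) (h - t') ≤ G * (s * K + s * H) :=
    (real_inner_le_norm _ _).trans (by gcongr)
  have i3 : inner ℝ a h ≤ s * H := (real_inner_le_norm _ _).trans (by gcongr)
  have i4 : inner ℝ (-((Γ - Γt) v)) h ≤ s * K * H := by
    refine (real_inner_le_norm _ _).trans ?_
    rw [norm_neg]
    gcongr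
  have i5 : ‖h - T.starProjection h‖ ^ 2 ≤ s * K ^ 2 := by
    calc ‖h - T.starProjection h‖ ^ 2 ≤ (s * K) ^ 2 := by gcongr
      _ = s * (s * K ^ 2) := by ring
      _ ≤ s * (1 * K ^ 2) := by gcongr
      _ = s * K ^ 2 := by ring
  have hfin : κ * ‖h‖ ^ 2 ≤ s * B := by
    have e : s * B = s * K ^ 2 + (s * H + G * (s * K + s * H) + s * H + s * K * H) := by
      rw [hB]; ring
    have := hκ h
    linarith
  have hhn : ‖h‖ ≤ √(s * B / κ) := by
    refine Real.le_sqrt_of_sq_le ?_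
    rw [le_div_iff₀ hκ0]
    linarith
  have hlast : g - -Γt v₀ = a - (Γ - Γt) v - Γt h := by
    simp only [hg, hh, map_sub, sub_apply]
    abel
  rw [hlast]
  have h1 := norm_sub_le (a - (Γ - Γt) v) (Γt h)
  have h2 := norm_sub_le a ((Γ - Γt) v)
  have h3 : ‖Γt h‖ ≤ ‖Γt‖ * √(s * B / κ) := (Γt.le_opNorm h).trans (by gcongr)
  linarith

/-! ### The penalized problem -/

theorem energy_sub_energy {J : Vec p → ℝ} {μ : ℝ} (hμ : 0 < μ) {Γ : Vec p →L[ℝ] Vec p}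
    (hΓ : Γ.IsPositive) (u x β : Vec p) :
    energy J μ u Γ x - energy J μ u Γ β = J x - J β - inner ℝ (μ⁻¹ • (u - Γ β)) (x - β)
      + 1 / (2 * μ) * inner ℝ (Γ (x - β)) (x - β) := by
  have hc := inner_apply_comm hΓ x β
  simp only [energy, map_sub, inner_sub_left, inner_sub_right, real_inner_smul_left,
    real_inner_comm x u, real_inner_comm β u, hc]
  field_simp
  ring

/-- First-order optimality on `M`. -/
theorem IsTangentSpace.fderiv_apply_eq_inner {J f : Vec p → ℝ} {M : Set (Vec p)} {β : Vec p}
    {T : Submodule ℝ (Vec p)} (hT : IsTangentSpace M β T) (hf : ContDiffAt ℝ 2 f β)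
    (hJf : ∀ᶠ x in 𝓝[M] β, J x = f x) {g : Vec p} {c : ℝ} {Γ : Vec p →L[ℝ] Vec p}
    (hmin : ∀ᶠ x in 𝓝[M] β, J β ≤ J x - inner ℝ g (x - β) + c * inner ℝ (Γ (x - β)) (x - β))
    {v : Vec p} (hv : v ∈ T) : fderiv ℝ f β v = inner ℝ g v := by
  obtain ⟨k, Φ, hΦ, rfl⟩ := hT
  set φ : Vec p → ℝ := fun x => f x - inner ℝ g (x - β) + c * inner ℝ (Γ (x - β)) (x - β) with hφ
  have hcd : ContDiffAt ℝ 2 φ β := by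
    have h1 : ContDiff ℝ 2 fun x : Vec p => inner ℝ g (x - β) :=
      contDiff_const.inner ℝ (by fun_prop)
    have h2 : ContDiff ℝ 2 fun x : Vec p => c * inner ℝ (Γ (x - β)) (x - β) := by
      have : ContDiff ℝ 2 fun x : Vec p => Γ (x - β) := by fun_prop
      exact contDiff_const.mul (this.inner ℝ (by fun_prop))
    exact (hf.sub h1.contDiffAt).add h2.contDiffAt
  have hβ : J β = f β := hJf.self_of_nhdsWithin hΦ.1
  have hext : IsLocalExtrOn φ M β := by
    refine Or.inl ?_
    filter_upwards [hmin, hJf] with x hx hxf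
    simp only [hφ, sub_self, map_zero, inner_zero_right, mul_zero, sub_zero, add_zero]
    rwa [hβ, hxf] at hx
  have h0 := hΦ.fderiv_apply_eq_zero hcd hext hv
  have hid : HasFDerivAt (fun x : Vec p => x - β) (ContinuousLinearMap.id ℝ (Vec p)) β :=
    (hasFDerivAt_id β).sub_const β
  have hd := ((hf.differentiableAt two_ne_zero).hasFDerivAt.sub
    ((innerSL ℝ g).hasFDerivAt.comp β hid)).add
      (((Γ.hasFDerivAt.comp β hid).inner ℝ hid).const_mul c)
  have hd' : fderiv ℝ φ β = _ := hd.fderiv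
  rw [hd'] at h0
  simp at h0
  linarith

theorem inner_eq_of_isLocalMinOn {J : Vec p → ℝ} {M : Set (Vec p)} {β : Vec p}
    (h : PartlySmoothAt J M β) {g : Vec p} {c : ℝ} {Γ : Vec p →L[ℝ] Vec p}
    (hmin : ∀ᶠ x in 𝓝[M] β, J β ≤ J x - inner ℝ g (x - β) + c * inner ℝ (Γ (x - β)) (x - β))
    {ψ : Vec p} (hψ : ψ ∈ subdiff J β) {v : Vec p} (hv : v ∈ modelSubspace J β) :
    inner ℝ ψ v = inner ℝ g v := by
  obtain ⟨V, f, hV, hβV, hcd, heq⟩ := h.smooth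
  have hJf : ∀ᶠ x in 𝓝[M] β, J x = f x := by
    filter_upwards [self_mem_nhdsWithin, nhdsWithin_le_nhds (hV.mem_nhds hβV)] with x hx hxV
    exact heq ⟨hx, hxV⟩
  have hf := hcd.contDiffAt (hV.mem_nhds hβV)
  rw [← h.sharp.fderiv_apply_eq_inner hf hJf hmin hv]
  -- The subgradient inequality says that `β` minimizes `J - ⟪ψ, ·⟫`, so `ψ` too represents the
  -- derivative along the tangent space.
  refine (h.sharp.fderiv_apply_eq_inner hf hJf (c := 0) (Γ := 0) (Eventually.of_forall fun x => ?_)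
    hv).symm
  have := hψ x
  linarith

/-- A local equation makes `M` relatively closed in small balls; this yields the constrained
minimizer. -/
theorem IsManifoldAround.eventually_isCompact_inter {M : Set (Vec p)} {β : Vec p}
    (h : IsManifoldAround M β) : ∀ᶠ r in 𝓝[>] (0 : ℝ), IsCompact (M ∩ Metric.closedBall β r) := by
  obtain ⟨k, Φ, -, -, V, hV, hβV, hΦ, hMV⟩ := h
  obtain ⟨r₀, hr₀, hball⟩ := Metric.nhds_basis_closedBall.mem_iff.1 (hV.mem_nhds hβV)
  filter_upwards [Ioc_mem_nhdsGT hr₀] with r hr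
  have hsub : Metric.closedBall β r ⊆ V := (Metric.closedBall_subset_closedBall hr.2).trans hball
  have heq : M ∩ Metric.closedBall β r = Metric.closedBall β r ∩ Φ ⁻¹' {0} := by
    ext x
    constructor
    · exact fun hx => ⟨hx.2, (hMV.subset ⟨hx.1, hsub hx.2⟩).2⟩
    · exact fun hx => ⟨(hMV.symm.subset ⟨hsub hx.1, hx.2⟩).1, hx.1⟩
  rw [heq]
  exact (isCompact_closedBall β r).of_isClosed_subset
    ((hΦ.continuousOn.mono hsub).preimage_isClosed_of_isClosed Metric.isClosed_closedBall
      isClosed_singleton) inter_subset_left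

/-- If only directions in `T_β` are maximal at `g` on `∂J(β)`, and `g` agrees with a subgradient
on `T_β`, then `g` is a subgradient. -/
theorem mem_subdiff_of_forall {J : Vec p → ℝ} {β g : Vec p} (hne : (subdiff J β).Nonempty)
    (hg : ∀ ψ ∈ subdiff J β, ∀ v ∈ modelSubspace J β, inner ℝ ψ v = inner ℝ g v)
    (hmax : ∀ d, (∀ ψ ∈ subdiff J β, inner ℝ ψ d ≤ inner ℝ g d) → d ∈ modelSubspace J β) :
    g ∈ subdiff J β := by
  by_contra hcon
  obtain ⟨l, c, hl, hlg⟩ :=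
    geometric_hahn_banach_closed_point (convex_subdiff J β) (isClosed_subdiff J β) hcon
  set d := (InnerProductSpace.toDual ℝ (Vec p)).symm l with hd
  have hld : ∀ x, l x = inner ℝ x d := fun x => by
    rw [real_inner_comm, hd, InnerProductSpace.toDual_symm_apply]
  obtain ⟨ψ, hψ⟩ := hne
  have hdT := hmax d fun ξ hξ => by
    rw [← hld, ← hld]
    exact ((hl ξ hξ).trans hlg).le
  have h1 := (hl ψ hψ).trans hlg
  rw [hld, hld, hg ψ hψ d hdT] at h1
  exact lt_irrefl _ h1

/-- Removing from `d` its component in `S` keeps it maximal, since `g` and the subgradients agree on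
`S`. The rest `n` is near `T` but orthogonal to `S`, which almost contains `T`: `‖n‖ ≤ (1/2 + 1/4)
‖n‖`, so `n = 0`. -/
theorem mem_of_maximal_direction {J : Vec p → ℝ} {β g : Vec p} {T : Submodule ℝ (Vec p)}
    (hg : ∀ ψ ∈ subdiff J β, ∀ v ∈ modelSubspace J β, inner ℝ ψ v = inner ℝ g v)
    (hT : ∀ t ∈ T, ∃ t' ∈ modelSubspace J β, ‖t - t'‖ ≤ 1 / 2 * ‖t‖)
    (hnear : ∀ d, (∀ ψ ∈ subdiff J β, inner ℝ ψ d ≤ inner ℝ g d) →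
      ‖d - T.starProjection d‖ ≤ 1 / 4 * ‖d‖)
    {d : Vec p} (hd : ∀ ψ ∈ subdiff J β, inner ℝ ψ d ≤ inner ℝ g d) :
    d ∈ modelSubspace J β := by
  set S := modelSubspace J β with hS
  set n := d - S.starProjection d with hn
  have hnS : n ∈ Sᗮ := S.sub_starProjection_mem_orthogonal d
  have hnmax : ∀ ψ ∈ subdiff J β, inner ℝ ψ n ≤ inner ℝ g n := fun ψ hψ => by
    rw [hn, inner_sub_right, inner_sub_right, hg ψ hψ _ (S.starProjection_apply_mem d)]
    linarith [hd ψ hψ]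
  have h1 := hnear n hnmax
  set t := T.starProjection n with ht
  obtain ⟨t', ht', hle⟩ := hT t (T.starProjection_apply_mem n)
  have h2 : ‖t‖ ^ 2 ≤ 1 / 2 * ‖t‖ * ‖n‖ := by
    have e1 : inner ℝ t n = ‖t‖ ^ 2 := by
      have h0 := T.sub_starProjection_mem_orthogonal n t (T.starProjection_apply_mem n)
      rw [inner_sub_right, sub_eq_zero] at h0
      rw [h0, ← ht, real_inner_self_eq_norm_sq]
    have e2 : inner ℝ t' n = 0 := hnS t' ht'
    calc ‖t‖ ^ 2 = inner ℝ (t - t') n := by rw [inner_sub_left, e1, e2, sub_zero]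
      _ ≤ ‖t - t'‖ * ‖n‖ := real_inner_le_norm _ _
      _ ≤ 1 / 2 * ‖t‖ * ‖n‖ := by gcongr
  have h3 : ‖t‖ ≤ 1 / 2 * ‖n‖ := by
    rcases (norm_nonneg t).eq_or_lt with h0 | h0
    · rw [← h0]; positivity
    · nlinarith
  have h4 : ‖n‖ ≤ ‖t‖ + ‖n - t‖ := norm_le_norm_add_norm_sub' n t
  have h5 : n = 0 := by
    rw [← norm_eq_zero]
    linarith [norm_nonneg n]
  rw [sub_eq_zero.1 (hn.symm.trans h5)]
  exact S.starProjection_apply_mem d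

/-- A point whose residual is a subgradient is the only solution, if moreover only directions in a
subspace on which `Γ` is definite are maximal at the residual on the subdifferential. -/
theorem solutions_eq_singleton {J : Vec p → ℝ} {μ : ℝ} (hμ : 0 < μ) {Γ : Vec p →L[ℝ] Vec p}
    (hΓ : Γ.IsPositive) {u β : Vec p} (hg : μ⁻¹ • (u - Γ β) ∈ subdiff J β)
    (hmax : ∀ d, (∀ ψ ∈ subdiff J β, inner ℝ ψ d ≤ inner ℝ (μ⁻¹ • (u - Γ β)) d) →
      inner ℝ (Γ d) d = 0 → d = 0) :
    solutions J μ u Γ = {β} := by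
  have hμ' : 0 < 1 / (2 * μ) := by positivity
  refine Subset.antisymm (fun x hx => ?_) ?_
  · have h1 := energy_sub_energy (J := J) hμ hΓ u x β
    have h2 := hx β
    have h3 := hg x
    have h4 := mul_nonneg hμ'.le (inner_apply_self_nonneg hΓ (x - β))
    have h5 : 1 / (2 * μ) * inner ℝ (Γ (x - β)) (x - β) = 0 := by linarith
    -- Equality of energies also gives `J x = J β + ⟪g, x - β⟫`, so every subgradient inequality at
    -- `β` says that `x - β` is maximal at `g`.
    refine sub_eq_zero.1 (hmax (x - β) (fun ψ hψ => ?_)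
      ((mul_eq_zero.1 h5).resolve_left hμ'.ne'))
    have h6 := hψ x
    linarith
  · refine singleton_subset_iff.2 fun x => ?_
    have h1 := energy_sub_energy (J := J) hμ hΓ u x β
    have h3 := hg x
    have h4 := mul_nonneg hμ'.le (inner_apply_self_nonneg hΓ (x - β))
    linarith

end PartlySmooth

end

/-! ### Distance estimate, choice of constants and the main theorem. -/

noncomputable section

namespace PartlySmooth

variable {p : ℕ}

/-- A point whose energy is at most that of `β₀`, in a direction where `Γ` is coercive, is at
distance `O(max ‖ε‖ μ)` from `β₀`, where `ε = u - Γ β₀`. -/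
theorem norm_sub_le_of_energy_le {J : Vec p → ℝ} {μ κ : ℝ} (hμ : 0 < μ) (hκ : 0 < κ)
    {Γ : Vec p →L[ℝ] Vec p} (hΓ : Γ.IsPositive) {u β β₀ η : Vec p} (hη : η ∈ subdiff J β₀)
    (hcoer : κ / 2 * ‖β - β₀‖ ^ 2 ≤ inner ℝ (Γ (β - β₀)) (β - β₀))
    (hle : energy J μ u Γ β ≤ energy J μ u Γ β₀) :
    ‖β - β₀‖ ≤ 4 / κ * (‖η‖ + 1) * max ‖u - Γ β₀‖ μ := by
  have h1 := energy_sub_energy (J := J) hμ hΓ u β β₀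
  have h2 := hη β
  set δ := β - β₀
  set ε := u - Γ β₀
  set m := max ‖ε‖ μ with hm
  have h3 : -(‖η‖ * ‖δ‖) ≤ inner ℝ η δ := neg_le_of_abs_le (abs_real_inner_le_norm η δ)
  have h4 : inner ℝ (μ⁻¹ • ε) δ ≤ μ⁻¹ * (m * ‖δ‖) := by
    rw [real_inner_smul_left]
    gcongr
    exact (real_inner_le_norm _ _).trans (by gcongr; exact le_max_left _ _)
  have h5 : 1 / (2 * μ) * (κ / 2 * ‖δ‖ ^ 2) ≤ (‖η‖ + μ⁻¹ * m) * ‖δ‖ := by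
    have := mul_le_mul_of_nonneg_left hcoer (by positivity : 0 ≤ 1 / (2 * μ))
    linarith
  have h6 : κ / 4 * ‖δ‖ ^ 2 ≤ (‖η‖ + 1) * m * ‖δ‖ := by
    have e : κ / 4 * ‖δ‖ ^ 2 = μ * (1 / (2 * μ) * (κ / 2 * ‖δ‖ ^ 2)) := by field_simp; ring
    calc κ / 4 * ‖δ‖ ^ 2 ≤ μ * ((‖η‖ + μ⁻¹ * m) * ‖δ‖) := by rw [e]; gcongr
      _ = (‖η‖ * μ + m) * ‖δ‖ := by field_simp
      _ ≤ (‖η‖ * m + m) * ‖δ‖ := by gcongr; exact le_max_right _ _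
      _ = (‖η‖ + 1) * m * ‖δ‖ := by ring
  have hm0 : 0 ≤ m := hμ.le.trans (le_max_right _ _)
  rcases (norm_nonneg δ).eq_or_lt with h0 | h0
  · rw [← h0]; positivity
  · have h7 : κ / 4 * ‖δ‖ ≤ (‖η‖ + 1) * m := by
      refine le_of_mul_le_mul_right ?_ h0
      linarith
    have e : 4 / κ * (‖η‖ + 1) * m = (‖η‖ + 1) * m / (κ / 4) := by field_simp
    rw [e, le_div_iff₀ (by positivity)]
    linarith

theorem exists_constants_of_isPositive {J : Vec p → ℝ} (hJ : ConvexOn ℝ univ J)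
    {β₀ : Vec p} {M : Set (Vec p)} (hM : LocallyPartlySmoothAt J M β₀)
    {Γt : Vec p →L[ℝ] Vec p} (hΓt : Γt.IsPositive)
    (hker : LinearMap.ker (Γt : Vec p →ₗ[ℝ] Vec p) ⊓ modelSubspace J β₀ = ⊥)
    (hη : preCertificate J β₀ Γt ∈ intrinsicInterior ℝ (subdiff J β₀)) :
    ∃ C > 0, ∃ K > 0, ∀ (μ : ℝ) (u : Vec p) (Γ : Vec p →L[ℝ] Vec p),
      0 < μ → Γ.IsPositive → u ∈ range Γ →
      max ‖Γ - Γt‖ (max (‖u - Γ β₀‖ * μ⁻¹) μ) ≤ C →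
      ∃ β : Vec p, solutions J μ u Γ = {β} ∧ β ∈ M ∧
        ‖β - β₀‖ ≤ K * max ‖u - Γ β₀‖ μ ∧
        (∀ c : ℝ, μ ≤ c * ‖u - Γ β₀‖ → ‖β - β₀‖ ≤ K * max 1 c * ‖u - Γ β₀‖) := by
  have hM' := hM
  obtain ⟨hβ₀, U, hU, hps⟩ := hM'
  have hps₀ := hps β₀ ⟨hβ₀, mem_of_mem_nhds hU⟩
  set T := modelSubspace J β₀ with hT
  obtain ⟨κ, hκ, hcoer⟩ := exists_coercive hΓt hker
  -- This is the first-order displacement that `(β - β₀)/μ` approximates.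
  set v₀ := -pinv (compress Γt T) (modelVector J β₀) with hv₀
  have hv₀T : v₀ ∈ T := T.neg_mem (pinv_compress_mem Γt T _)
  set η := preCertificate J β₀ Γt with hη_def
  have hηv : η = -Γt v₀ := by rw [hv₀, map_neg, neg_neg]; rfl
  have hηJ : η ∈ subdiff J β₀ := intrinsicInterior_subset hη
  obtain ⟨c, hc, hnormal⟩ := hps₀.inner.eventually_norm_sub_starProjection_le hη
  set K := 4 / κ * (‖η‖ + 1) with hK
  have hK0 : 0 < K := by positivity
  set τ := min 1 (κ / 4) with hτ
  have hτ0 : 0 < τ := by positivity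
  have hτ2 : τ ^ 2 ≤ κ / 4 := by
    have h1 : τ ≤ 1 := min_le_left _ _
    have h2 : τ ≤ κ / 4 := min_le_right _ _
    nlinarith
  -- Maximal directions then deviate from `T` by at most `τ` (for coercivity) and `1 / 4` (for
  -- `mem_of_maximal_direction`).
  set ρ := min τ (1 / 4) / (2 * c) with hρ
  have hρ0 : 0 < ρ := by positivity
  have hcρ : c * (ρ + ρ) = min τ (1 / 4) := by rw [hρ]; field_simp; ring
  obtain ⟨s, hs, hcert⟩ := exists_pos_forall_norm_certificate_sub_le hκ hcoer hv₀T hK0 hρ0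
  rw [← hηv] at hcert
  have hev := (hM.eventually_exists_near_mem_modelSubspace (lt_min hs one_half_pos)).and <|
    (hps₀.sharp.eventually_norm_sub_starProjection_le (lt_min hs hτ0)).and <|
    (hps₀.inner.eventually_exists_near hηJ hs).and <|
    (hnormal ρ hρ0).and <| (nhdsWithin_le_nhds hU : ∀ᶠ β in 𝓝[M] β₀, β ∈ U)
  obtain ⟨r₁, hr₁, hball⟩ := Metric.mem_nhdsWithin_iff.1 hev
  obtain ⟨r, hcomp, hr0, hr⟩ :=
    (hps₀.manifold.eventually_isCompact_inter.and (Ioo_mem_nhdsGT hr₁)).exists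
  -- Here `κ / 4` serves coercivity, `s` the certificate, `1` gives `‖ε‖ ≤ μ`, and `r / (2 * K)`
  -- puts `β` within `r / 2` of `β₀`.
  refine ⟨min (min (κ / 4) s) (min 1 (r / (2 * K))), by positivity, K, hK0, ?_⟩
  intro μ u Γ hμ hΓ _ hmax
  obtain ⟨hmax₁, hmax₂⟩ := le_min_iff.1 hmax
  obtain ⟨hmaxκ, hmaxs⟩ := le_min_iff.1 hmax₁
  obtain ⟨hmax1, hmaxr⟩ := le_min_iff.1 hmax₂
  have hΓκ : ‖Γ - Γt‖ ≤ κ / 4 := (max_le_iff.1 hmaxκ).1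
  have hΓs : ‖Γ - Γt‖ ≤ s := (max_le_iff.1 hmaxs).1
  have hεs : ‖u - Γ β₀‖ * μ⁻¹ ≤ s := (max_le_iff.1 (max_le_iff.1 hmaxs).2).1
  have hε1 : ‖u - Γ β₀‖ * μ⁻¹ ≤ 1 := (max_le_iff.1 (max_le_iff.1 hmax1).2).1
  have hμr : μ ≤ r / (2 * K) := (max_le_iff.1 (max_le_iff.1 hmaxr).2).2
  have hεμ : ‖u - Γ β₀‖ ≤ μ := by
    rw [← div_eq_mul_inv, div_le_one hμ] at hε1
    exact hε1
  have hcontE : Continuous (energy J μ u Γ) := by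
    have := hJ.locallyLipschitz.continuous
    unfold energy
    fun_prop
  obtain ⟨β, ⟨hβM, hβr⟩, hβmin⟩ := hcomp.exists_isMinOn
    ⟨β₀, hβ₀, Metric.mem_closedBall_self hr0.le⟩ hcontE.continuousOn
  have hβmin' : ∀ x ∈ M ∩ Metric.closedBall β₀ r, energy J μ u Γ β ≤ energy J μ u Γ x :=
    fun x hx => hβmin hx
  obtain ⟨hnear, htan, ⟨ψ, hψ, hψη⟩, hdir, hβU⟩ :=
    hball ⟨Metric.closedBall_subset_ball hr hβr, hβM⟩
  have hpsβ := hps β ⟨hβM, hβU⟩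
  have hposΓ : ∀ d, ‖d - T.starProjection d‖ ≤ τ * ‖d‖ →
      κ / 2 * ‖d‖ ^ 2 ≤ inner ℝ (Γ d) d := fun d hd => half_coercive hcoer hτ2 hΓκ hd
  have hbound : ‖β - β₀‖ ≤ K * max ‖u - Γ β₀‖ μ :=
    norm_sub_le_of_energy_le hμ hκ hΓ hηJ
      (hposΓ _ (htan.trans (by gcongr; exact min_le_right _ _)))
      (hβmin' β₀ ⟨hβ₀, Metric.mem_closedBall_self hr0.le⟩)
  have hboundμ : ‖β - β₀‖ ≤ K * μ := by rwa [max_eq_right hεμ] at hbound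
  have hβint : β ∈ Metric.ball β₀ r := by
    rw [Metric.mem_ball, dist_eq_norm]
    have : K * μ ≤ K * (r / (2 * K)) := by gcongr
    have e : K * (r / (2 * K)) = r / 2 := by field_simp
    linarith
  set g := μ⁻¹ • (u - Γ β) with hg
  have hfirst : ∀ ξ ∈ subdiff J β, ∀ v ∈ modelSubspace J β, inner ℝ ξ v = inner ℝ g v := by
    intro ξ hξ v hv
    refine inner_eq_of_isLocalMinOn hpsβ (c := 1 / (2 * μ)) (Γ := Γ) ?_ hξ hv
    filter_upwards [self_mem_nhdsWithin,
      nhdsWithin_le_nhds (Metric.isOpen_ball.mem_nhds hβint)] with x hxM hxr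
    have h1 := energy_sub_energy (J := J) hμ hΓ u x β
    have h2 := hβmin' x ⟨hxM, Metric.ball_subset_closedBall hxr⟩
    linarith
  have hgη : ‖g - η‖ ≤ ρ := by
    have e : g = μ⁻¹ • (u - Γ β₀) - Γ (μ⁻¹ • (β - β₀)) := by
      rw [hg, map_smul, ← smul_sub, map_sub]
      congr 1
      abel
    have hμinv : ‖μ⁻¹‖ = μ⁻¹ := Real.norm_of_nonneg (inv_nonneg.2 hμ.le)
    rw [e]
    rw [e] at hfirst
    refine hcert (modelSubspace J β) Γ _ _ ψ hΓs ?_ ?_ ?_ hψη ?_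
      (hfirst ψ hψ)
    · rwa [norm_smul, hμinv, mul_comm]
    · rw [norm_smul, hμinv, inv_mul_le_iff₀ hμ, mul_comm]
      exact hboundμ
    · rw [map_smul, ← smul_sub, norm_smul, norm_smul, mul_left_comm]
      gcongr
      exact htan.trans (by gcongr; exact min_le_left _ _)
    · intro t ht
      obtain ⟨t', ht', hle⟩ := hnear t ht
      exact ⟨t', ht', hle.trans (by gcongr; exact min_le_left _ _)⟩
  have hdirle : ∀ d, (∀ ξ ∈ subdiff J β, inner ℝ ξ d ≤ inner ℝ g d) →
      ‖d - T.starProjection d‖ ≤ min τ (1 / 4) * ‖d‖ := by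
    intro d hd
    refine (hdir g d hd).trans ?_
    rw [← hcρ]
    gcongr
  have hmaxdir : ∀ d, (∀ ξ ∈ subdiff J β, inner ℝ ξ d ≤ inner ℝ g d) →
      d ∈ modelSubspace J β := fun d hd => by
    refine mem_of_maximal_direction (T := T) hfirst (fun t ht => ?_) (fun d hd => ?_) hd
    · obtain ⟨t', ht', hle⟩ := hnear t ht
      exact ⟨t', ht', hle.trans (by gcongr; exact min_le_right _ _)⟩
    · exact (hdirle d hd).trans (by gcongr; exact min_le_right _ _)
  have hgJ : g ∈ subdiff J β := mem_subdiff_of_forall ⟨ψ, hψ⟩ hfirst hmaxdir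
  refine ⟨β, solutions_eq_singleton hμ hΓ hgJ fun d hd h0 => ?_, hβM, hbound, fun a ha => ?_⟩
  · have h1 := hposΓ d ((hdirle d hd).trans (by gcongr; exact min_le_left _ _))
    rw [h0] at h1
    have h2 : ‖d‖ ^ 2 = 0 := le_antisymm (by nlinarith) (sq_nonneg _)
    exact norm_eq_zero.1 (pow_eq_zero_iff two_ne_zero |>.1 h2)
  · refine hbound.trans ?_
    rw [mul_assoc K, max_mul_of_nonneg _ _ (norm_nonneg _), one_mul]
    exact mul_le_mul_of_nonneg_left (max_le_max le_rfl ha) hK0.le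

end PartlySmooth

end

theorem theorem1 {p : ℕ} (J : PartlySmooth.Vec p → ℝ) (hJ : ConvexOn ℝ Set.univ J)
    (β₀ : PartlySmooth.Vec p) (M : Set (PartlySmooth.Vec p))
    (hM : PartlySmooth.LocallyPartlySmoothAt J M β₀)
    (Γt : PartlySmooth.Vec p →L[ℝ] PartlySmooth.Vec p)
    (hker : LinearMap.ker (Γt : PartlySmooth.Vec p →ₗ[ℝ] PartlySmooth.Vec p) ⊓
      PartlySmooth.modelSubspace J β₀ = ⊥)
    (hη : PartlySmooth.preCertificate J β₀ Γt ∈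
      intrinsicInterior ℝ (PartlySmooth.subdiff J β₀)) :
    ∃ C > 0, ∃ K > 0, ∀ (μ : ℝ) (u : PartlySmooth.Vec p)
      (Γ : PartlySmooth.Vec p →L[ℝ] PartlySmooth.Vec p),
      0 < μ → Γ.IsPositive → u ∈ Set.range Γ →
      max ‖Γ - Γt‖ (max (‖u - Γ β₀‖ * μ⁻¹) μ) ≤ C →
      ∃ β : PartlySmooth.Vec p,
        PartlySmooth.solutions J μ u Γ = {β} ∧
        β ∈ M ∧
        ‖β - β₀‖ ≤ K * max ‖u - Γ β₀‖ μ ∧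
        (∀ c : ℝ, μ ≤ c * ‖u - Γ β₀‖ → ‖β - β₀‖ ≤ K * max 1 c * ‖u - Γ β₀‖) := by
  open PartlySmooth in
  -- Positive operators form a closed set, so if `Γt` is not positive, no admissible `Γ` exists near
  -- it and the claim is vacuous for small `C`.
  by_cases hΓt : Γt.IsPositive
  swap
  · obtain ⟨C, hC, hball⟩ := Metric.nhds_basis_closedBall.mem_iff.1
      (isClosed_isPositive.isOpen_compl.mem_nhds hΓt)
    refine ⟨C, hC, 1, one_pos, fun μ u Γ _ hΓ _ hle => absurd hΓ (hball (?_ : Γ ∈ _))⟩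
    rw [Metric.mem_closedBall, dist_eq_norm]
    exact (le_max_left _ _).trans hle
  · exact exists_constants_of_isPositive hJ hM hΓt hker hη
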